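/- Let $G$ be a simply connected (in particular connected) real Lie group, i.e. a finite-dimensional, smooth, Hausdorff, second countable one, with unit $e$ and Lie algebra $\mathfrak g=T_eG$, and let $\mathrm{Ad}_g=T_gR_{g^{-1}}\circ T_eL_g$ be its adjoint representation, where $L_g$ and $R_g$ denote left and right multiplication by $g$. Let $$Z^1_{\mathrm{sm}}(G,\mathrm{Ad})=\{\xi\in C^\infty(G,\mathfrak g)\;:\;\xi(gh)=\mathrm{Ad}_g(\xi(h))+\xi(g)\ \text{ for all } g,h\in G\}$$ be the real vector space of smooth group 1-cocycles, and let $$Z^1_{\mathrm{CE}}(\mathfrak g,\mathrm{ad})=\{\omega\in\mathrm{End}(\mathfrak g)\;:\;[X,\omega(Y)]-[Y,\omega(X)]-\omega([X,Y])=0\ \text{ for all } X,Y\in\mathfrak g\}$$ be the space of Chevalley–Eilenberg 1-cocycles. Then $Z^1_{\mathrm{CE}}(\mathfrak g,\mathrm{ad})=\mathrm{Der}(\mathfrak g)$, the space of derivations of the Lie algebra $\mathfrak g$, and the linear map $T_e\colon C^\infty(G,\mathfrak g)\to\mathrm{End}(\mathfrak g)$, $\xi\mapsto T_e\xi$ (with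 $T_{\xi(e)}\mathfrak g$ identified with $\mathfrak g$), restricts to an isomorphism of $\mathbb R$-vector spaces $$T_e\colon Z^1_{\mathrm{sm}}(G,\mathrm{Ad})\;\stackrel{\sim}{\longrightarrow}\;\mathrm{Der}(\mathfrak g)=Z^1_{\mathrm{CE}}(\mathfrak g,\mathrm{ad}).$$ -/

import Mathlib

open scoped Manifold ContDiff

noncomputable section

namespace VanEst

/-- A smooth Lie group is in particular regular enough for Mathlib's Lie bracket on its tangent
space at the identity. -/
instance leInftyMinSmoothness : ENat.LEInfty (minSmoothness ℝ 3) :=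
  ⟨by
    rw [minSmoothness_of_isRCLikeNormedField]
    exact ENat.LEInfty.out⟩

variable {E : Type*} [NormedAddCommGroup E] [NormedSpace ℝ E]
  {H : Type*} [TopologicalSpace H] (I : ModelWithCorners ℝ E H)
  (G : Type*) [TopologicalSpace G] [ChartedSpace H G] [Group G]

/-- The adjoint representation `Ad_g = T_g R_{g⁻¹} ∘ T_e L_g` of `G` on its Lie algebra `T_e G`.
(Source and target of the two tangent maps are `T_e G → T_{g e} G = T_g G → T_{g g⁻¹} G = T_e G`.) -/
def Ad {G : Type*} [TopologicalSpace G] [ChartedSpace H G] [Group G] (g : G) :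
    GroupLieAlgebra I G →L[ℝ] GroupLieAlgebra I G :=
  ContinuousLinearMap.comp (M₁ := GroupLieAlgebra I G) (M₂ := TangentSpace I g)
    (M₃ := GroupLieAlgebra I G)
    (mfderiv I I (fun h : G => h * g⁻¹) g) (mfderiv I I (fun h : G => g * h) 1)

/-- Smooth group 1-cochains `C¹_sm(G, Ad) = C^∞(G, 𝔤)`. The Lie algebra `𝔤 = T_e G` is, as a
vector space, the model space `E` (by the definition of the tangent space in Mathlib), and its
smooth structure is that of `E`. -/
abbrev SmoothOneCochain : Type _ := C^∞⟮I, G; 𝓘(ℝ, E), E⟯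

variable {G} in
/-- The value in `𝔤` of a smooth 1-cochain at a group element. -/
def SmoothOneCochain.val (ξ : SmoothOneCochain I G) (g : G) : GroupLieAlgebra I G := ξ g

/-- The space `Z¹_sm(G, Ad)` of smooth group 1-cocycles: the smooth maps `ξ : G → 𝔤` such that
`ξ(gh) = Ad_g(ξ(h)) + ξ(g)` for all `g`, `h`. -/
def smoothOneCocycles : Submodule ℝ (SmoothOneCochain I G) where
  carrier := {ξ | ∀ g h : G, ξ.val I (g * h) = Ad I g (ξ.val I h) + ξ.val I g}
  zero_mem' := fun g h => by
    have h0 : ∀ k : G, SmoothOneCochain.val I (0 : SmoothOneCochain I G) k = 0 := fun _ => rfl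
    simp only [h0, map_zero, add_zero]
  add_mem' := by
    intro ξ η hξ hη g h
    have h0 : ∀ k : G, SmoothOneCochain.val I (ξ + η) k = ξ.val I k + η.val I k := fun _ => rfl
    rw [h0, h0, h0, hξ g h, hη g h, map_add]
    abel
  smul_mem' := by
    intro c ξ hξ g h
    have h0 : ∀ k : G, SmoothOneCochain.val I (c • ξ) k = c • ξ.val I k := fun _ => rfl
    rw [h0, h0, h0, hξ g h, map_smul, smul_add]

/-- The tangent map at the identity, `T_e : C¹_sm(G, Ad) = C^∞(G, 𝔤) → End(𝔤) = C¹_CE(𝔤, ad)`,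
as a linear map. (The target `T_{ξ(e)} 𝔤` of `T_e ξ` is identified with the vector space `𝔤`.) -/
def tangentMap₁ :
    SmoothOneCochain I G →ₗ[ℝ] (GroupLieAlgebra I G →ₗ[ℝ] GroupLieAlgebra I G) where
  toFun ξ := ContinuousLinearMap.toLinearMap (M₂ := GroupLieAlgebra I G)
    (mfderiv I 𝓘(ℝ, E) (fun g : G => (ξ g : E)) 1)
  map_add' ξ η := by
    have hξ : MDifferentiableAt I 𝓘(ℝ, E) (fun g : G => ξ g) 1 :=
      ξ.contMDiff.contMDiffAt.mdifferentiableAt (by simp)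
    have hη : MDifferentiableAt I 𝓘(ℝ, E) (fun g : G => η g) 1 :=
      η.contMDiff.contMDiffAt.mdifferentiableAt (by simp)
    have h := mfderiv_add hξ hη
    ext v
    exact congrArg (fun L : E →L[ℝ] E => L v) h
  map_smul' c ξ := by
    have hξ : MDifferentiableAt I 𝓘(ℝ, E) (fun g : G => ξ g) 1 :=
      ξ.contMDiff.contMDiffAt.mdifferentiableAt (by simp)
    have h := const_smul_mfderiv hξ c
    ext v
    exact congrArg (fun L : E →L[ℝ] E => L v) h

/-- The space `Z¹_CE(𝔤, ad)` of Chevalley–Eilenberg 1-cocycles of a real Lie algebra `𝔤` with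
values in its adjoint representation: the kernel of
`(dω)(X, Y) = [X, ω(Y)] - [Y, ω(X)] - ω([X, Y])`. -/
def ceOneCocycles (L : Type*) [LieRing L] [LieAlgebra ℝ L] : Submodule ℝ (L →ₗ[ℝ] L) :=
  LinearMap.ker (LieModule.Cohomology.d₁₂ ℝ L L)

end VanEst

end

/-!
Let `D` be an endomorphism of the Lie algebra, and let `η` be the `1`-form on the group with values
in the Lie algebra that is `Ad_g (D v)` on the value at `g` of the left-invariant field `v^L`. A
smooth map `ξ` with `ξ(1) = 0` is a cocycle with derivative `D` at `1` if and only if `dξ = η`.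
Indeed, differentiating the cocycle identity in the second variable gives `dξ = η`
(`isPrimitiveAt_of_cocycle`). Conversely, for fixed `g` the two sides of the cocycle identity, as
functions of the product, are primitives of `η` which agree at `g`, and so they agree on the
connected group (`cocycle_of_isPrimitiveAt`).

Since the derivative of `Ad` along `w^L` is `Ad ∘ ad w` (`fderiv_chartAd`), the formula
`dη (V, W) = V (η W) - W (η V) - η [V, W]` shows that
`dη (v^L, w^L) = Ad ([v, D w] - [w, D v] - D [v, w])` (`fderiv_apply_sub_fderiv_apply`). So `η` is
closed exactly when `D` is a Chevalley-Eilenberg cocycle. In particular the derivative at `1` of a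
cocycle is a derivation, and it determines the cocycle because the group is connected.

If `D` is a derivation, the Poincaré lemma gives a primitive of `η` near `1`, and left translations
carry it to a primitive near every other point. Two local primitives differ by locally constant
functions; as the group is simply connected, they can be glued to a global primitive by lifting the
identity through the covering by germs of primitives (`exists_forall_eventually_sub_eq`). The global
primitive that vanishes at `1` is the required cocycle.

Brackets and second derivatives are computed in the extended chart around `1`. There, the formula
for the derivative of `Ad` at `1` comes from the symmetry of the second derivative of the
multiplication (`fderiv_chartAd_unitCoord`).
-/

noncomputable section

namespace VanEst

open scoped Topology
open VectorField Set Filter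

/-! ### Gluing functions that differ by locally constant functions -/

section

/-- On a simply connected, locally path connected space, a family of functions on an open cover
whose differences are locally constant can be corrected by locally constant functions to a global
function. -/
theorem exists_forall_eventually_sub_eq {X A ι : Type*} [TopologicalSpace X]
    [SimplyConnectedSpace X] [LocallyPathConnectedSpace X] [AddCommGroup A]
    (U : ι → Set X) (hU : ∀ i, IsOpen (U i)) (idx : X → ι) (hidx : ∀ x, x ∈ U (idx x))
    (f : ι → X → A)
    (hf : ∀ i j, ∀ x ∈ U i ∩ U j, ∀ᶠ y in 𝓝 x, f i y - f j y = f i x - f j x) :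
    ∃ ξ : X → A, ∀ i, ∀ x ∈ U i, ∀ᶠ y in 𝓝 x, ξ y - f i y = ξ x - f i x := by
  let _ : TopologicalSpace A := ⊥
  have : DiscreteTopology A := ⟨rfl⟩
  -- The covering whose fibre over `x` consists of the germs at `x` of functions differing from the
  -- `f i` by constants; the germ of `f i + v` has coordinate `v` over `U i`.
  let Z : FiberBundleCore ι X A :=
    { baseSet := U
      isOpen_baseSet := hU
      indexAt := idx
      mem_baseSet_at := hidx
      coordChange := fun i j x v => v + f i x - f j x
      coordChange_self := fun i x _ v => by simp
      continuousOn_coordChange := fun i j => by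
        rintro ⟨x, v⟩ ⟨hx, -⟩
        refine ContinuousAt.continuousWithinAt ?_
        have h1 : ∀ᶠ p : X × A in 𝓝 (x, v), f i p.1 - f j p.1 = f i x - f j x :=
          (continuous_fst.tendsto (x, v)).eventually (hf i j x hx)
        have h2 : ∀ᶠ p : X × A in 𝓝 (x, v), p.2 = v :=
          (continuous_snd.tendsto (x, v)).eventually
            (p := fun w => w = v) (by simp [nhds_discrete])
        refine (continuousAt_const (y := v + f i x - f j x)).congr ?_
        filter_upwards [h1, h2] with p hp hp'
        rw [hp', add_sub_assoc, add_sub_assoc, hp]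
      coordChange_comp := fun i j k x _ v => by abel }
  obtain ⟨x₀⟩ : Nonempty X := inferInstance
  have hcov : IsCoveringMap (Bundle.TotalSpace.proj : Z.TotalSpace → X) :=
    FiberBundle.isCoveringMap (F := A) (E := Z.Fiber)
  obtain ⟨s, ⟨-, hs⟩, -⟩ := hcov.existsUnique_continuousMap_lifts (ContinuousMap.id X) x₀
    (⟨x₀, (0 : A)⟩ : Z.TotalSpace) rfl
  have hs' : ∀ x, (s x).proj = x := fun x => congrFun hs x
  let germ (x : X) : A := (s x).2
  let c (i : ι) (x : X) : A := (Z.localTriv i (s x)).2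
  have hc (i : ι) (x : X) : c i x = germ x + f (idx x) x - f i x := by
    change germ x + f (idx (s x).proj) (s x).proj - f i (s x).proj = _
    rw [hs']
  refine ⟨fun x => germ x + f (idx x) x, fun i x hx => ?_⟩
  have h1 : ContinuousAt (c i) x := by
    have hm : s x ∈ (Z.localTriv i).source := by
      rw [(Z.localTriv i).mem_source]
      change (s x).proj ∈ U i
      rwa [hs']
    exact (continuous_snd.continuousAt.comp
      (((Z.localTriv i).continuousAt hm).comp s.continuous.continuousAt))
  have h2 : ∀ᶠ y in 𝓝 x, c i y = c i x :=
    h1.eventually (p := fun a => a = c i x) (by simp [nhds_discrete])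
  filter_upwards [h2] with y hy
  rw [← hc, ← hc, hy]

end

/-! ### Derivatives between model spaces -/

section

variable {E : Type*} [NormedAddCommGroup E] [NormedSpace ℝ E]
  {H : Type*} [TopologicalSpace H] (I : ModelWithCorners ℝ E H)
  {M : Type*} [TopologicalSpace M] [ChartedSpace H M]
  {E' : Type*} [NormedAddCommGroup E'] [NormedSpace ℝ E']
  {H' : Type*} [TopologicalSpace H'] (I' : ModelWithCorners ℝ E' H')
  {M' : Type*} [TopologicalSpace M'] [ChartedSpace H' M']
  {E'' : Type*} [NormedAddCommGroup E''] [NormedSpace ℝ E'']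
  {H'' : Type*} [TopologicalSpace H''] (I'' : ModelWithCorners ℝ E'' H'')
  {M'' : Type*} [TopologicalSpace M''] [ChartedSpace H'' M'']

/-- The manifold derivative, with its tangent spaces replaced by the model vector spaces to which
they are equal by definition. The type no longer depends on the base points, which makes rewriting
them possible. -/
def modelDeriv (f : M → M') (x : M) : E →L[ℝ] E' := mfderiv I I' f x

variable {I I' I''}

theorem modelDeriv_comp {g : M' → M''} {f : M → M'} (x : M)
    (hg : MDifferentiableAt I' I'' g (f x)) (hf : MDifferentiableAt I I' f x) :
    modelDeriv I I'' (fun y => g (f y)) x =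
      (modelDeriv I' I'' g (f x)).comp (modelDeriv I I' f x) :=
  mfderiv_comp x hg hf

theorem modelDeriv_id (x : M) : modelDeriv I I (fun y : M => y) x = ContinuousLinearMap.id ℝ E :=
  mfderiv_id

theorem modelDeriv_const (x : M) (c : M') : modelDeriv I I' (fun _ : M => c) x = 0 :=
  mfderiv_const

theorem modelDeriv_congr {f g : M → M'} {x : M} (h : f =ᶠ[𝓝 x] g) :
    modelDeriv I I' f x = modelDeriv I I' g x :=
  Filter.EventuallyEq.mfderiv_eq h

theorem modelDeriv_eq_fderiv {f : E → E'} (x : E) :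
    modelDeriv 𝓘(ℝ, E) 𝓘(ℝ, E') f x = fderiv ℝ f x :=
  mfderiv_eq_fderiv

end

/-! ### The adjoint representation -/

section

variable {E : Type*} [NormedAddCommGroup E] [NormedSpace ℝ E]
  {H : Type*} [TopologicalSpace H] (I : ModelWithCorners ℝ E H)
  {G : Type*} [TopologicalSpace G] [ChartedSpace H G] [Group G]

/-- The adjoint representation, as operators on the model space. -/
def AdE (g : G) : E →L[ℝ] E := Ad I g

/-- The left-invariant vector field with value `v` at `1`, as a function to the model space. -/
def leftField (v : E) (g : G) : E := mulInvariantVectorField (I := I) (G := G) v g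

theorem leftField_eq (v : E) (g : G) :
    leftField I v g = modelDeriv I I (fun h : G => g * h) 1 v := rfl

theorem AdE_eq (g : G) : AdE I g =
    (modelDeriv I I (fun h : G => h * g⁻¹) g).comp (modelDeriv I I (fun h : G => g * h) 1) := rfl

variable {I} [LieGroup I ∞ G]

theorem mdifferentiableAt_mul_left (g h : G) : MDifferentiableAt I I (fun k : G => g * k) h :=
  (contMDiff_mul_left (I := I) (n := ∞)).contMDiffAt.mdifferentiableAt (by simp)

theorem mdifferentiableAt_mul_right (g h : G) : MDifferentiableAt I I (fun k : G => k * g) h :=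
  (contMDiff_mul_right (I := I) (n := ∞)).contMDiffAt.mdifferentiableAt (by simp)

theorem mdifferentiableAt_conj (g h : G) :
    MDifferentiableAt I I (fun k : G => g * k * g⁻¹) h :=
  ((contMDiff_mul_right (I := I) (n := ∞) (a := g⁻¹)).comp
      (contMDiff_mul_left (I := I) (n := ∞) (a := g))).contMDiffAt.mdifferentiableAt (by simp)

/-- `Ad_g` is the derivative at `1` of the conjugation by `g`. -/
theorem AdE_eq_modelDeriv_conj (g : G) :
    AdE I g = modelDeriv I I (fun h : G => g * h * g⁻¹) 1 := by
  rw [AdE_eq, modelDeriv_comp (f := fun h : G => g * h) (g := fun h : G => h * g⁻¹) (1 : G)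
    (mdifferentiableAt_mul_right _ _) (mdifferentiableAt_mul_left _ _), mul_one]

theorem AdE_one : AdE I (1 : G) = ContinuousLinearMap.id ℝ E := by
  rw [AdE_eq_modelDeriv_conj]
  simpa using modelDeriv_id (I := I) (1 : G)

theorem AdE_mul (g h : G) : AdE I (g * h) = (AdE I g).comp (AdE I h) := by
  rw [AdE_eq_modelDeriv_conj h]
  have := modelDeriv_comp (f := fun k : G => h * k * h⁻¹) (g := fun k : G => g * k * g⁻¹) (1 : G)
    (mdifferentiableAt_conj (I := I) _ _) (mdifferentiableAt_conj (I := I) _ _)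
  rw [mul_one, mul_inv_cancel, ← AdE_eq_modelDeriv_conj g] at this
  rw [← this, AdE_eq_modelDeriv_conj]
  simp [mul_assoc]

theorem AdE_mul_apply (g h : G) (v : E) : AdE I (g * h) v = AdE I g (AdE I h v) := by
  rw [AdE_mul]; rfl

theorem contMDiff_AdE : ContMDiff I 𝓘(ℝ, E →L[ℝ] E) ∞ (fun g : G => AdE I g) := by
  intro g₀
  have hf : ContMDiffAt (I.prod I) I ∞
      (Function.uncurry (fun g h : G => g * h * g⁻¹)) (g₀, (1 : G)) := by
    have : ContMDiff (I.prod I) I ∞ (Function.uncurry (fun g h : G => g * h * g⁻¹)) :=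
      (contMDiff_fst.mul contMDiff_snd).mul contMDiff_fst.inv
    exact this.contMDiffAt
  have := ContMDiffAt.mfderiv (m := ∞) (n := ∞) (fun g h : G => g * h * g⁻¹) (fun _ => (1 : G))
    hf contMDiffAt_const (by simp)
  refine this.congr_of_eventuallyEq (.of_forall fun g => ?_)
  -- Every conjugation fixes `1`, so the coordinate changes in `ContMDiffAt.mfderiv` are
  -- those from the preferred chart at `1` to itself.
  have e : ∀ g : G, g * 1 * g⁻¹ = 1 := by simp
  have e2 := inTangentCoordinates_eq (I := I) (I' := I) (x₀ := g₀) (x := g)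
    (fun _ => (1 : G)) (fun g : G => g * 1 * g⁻¹)
    (fun g => modelDeriv I I (fun h : G => g * h * g⁻¹) 1)
    (by simp) (by simp)
  refine Eq.trans ?_ e2.symm
  rw [← AdE_eq_modelDeriv_conj]
  ext v
  simp only [e, ContinuousLinearMap.comp_apply]
  rw [(tangentBundleCore I G).coordChange_self (achart H (1 : G)) 1 (mem_achart_source H 1),
    (tangentBundleCore I G).coordChange_self (achart H (1 : G)) 1 (mem_achart_source H 1)]

/-- At `g`, the left-invariant field of `v` equals the right-invariant field of `Ad_g v`. -/
theorem modelDeriv_mul_right_AdE (g : G) (v : E) :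
    modelDeriv I I (fun h : G => h * g) 1 (AdE I g v) = leftField I v g := by
  have := modelDeriv_comp (f := fun k : G => g * k * g⁻¹) (g := fun k : G => k * g) (1 : G)
    (mdifferentiableAt_mul_right (I := I) _ _) (mdifferentiableAt_conj (I := I) _ _)
  rw [mul_one, mul_inv_cancel, ← AdE_eq_modelDeriv_conj g] at this
  rw [leftField_eq, ← ContinuousLinearMap.comp_apply, ← this]
  simp

/-- Left-invariant fields are preserved by left translations. -/
theorem leftField_mul (g h : G) (v : E) :
    leftField I v (g * h) = modelDeriv I I (fun k : G => g * k) h (leftField I v h) := by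
  have := modelDeriv_comp (f := fun k : G => h * k) (g := fun k : G => g * k) (1 : G)
    (mdifferentiableAt_mul_left (I := I) _ _) (mdifferentiableAt_mul_left (I := I) _ _)
  rw [leftField_eq, leftField_eq, ← ContinuousLinearMap.comp_apply]
  simpa [mul_assoc] using congrArg (fun L : E →L[ℝ] E => L v) this

end

/-! ### Left-invariant fields and the adjoint representation in the chart around the unit -/

section

variable {E : Type*} [NormedAddCommGroup E] [NormedSpace ℝ E]
  {H : Type*} [TopologicalSpace H] (I : ModelWithCorners ℝ E H)
  (G : Type*) [TopologicalSpace G] [ChartedSpace H G] [Group G]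

/-- The extended chart of the group around its unit. -/
abbrev unitChart : PartialEquiv G E := extChartAt I (1 : G)

/-- The coordinates of the unit in the chart around it. -/
def unitCoord : E := unitChart I G 1

/-- The multiplication in the chart around the unit. -/
def chartMul (p : E × E) : E :=
  unitChart I G ((unitChart I G).symm p.1 * (unitChart I G).symm p.2)

/-- The left-invariant vector field with value `v` at `1`, read in the chart around the unit. -/
def chartField (v x : E) : E :=
  modelDeriv I 𝓘(ℝ, E) (unitChart I G) ((unitChart I G).symm x)
    (leftField I v ((unitChart I G).symm x))

/-- The adjoint representation, read in the chart around the unit. -/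
def chartAd (x : E) : E →L[ℝ] E := AdE I ((unitChart I G).symm x)

/-- The Lie bracket of `T_e G`, on the model space. -/
def bracketE (v w : E) : E := @Bracket.bracket (GroupLieAlgebra I G) (GroupLieAlgebra I G) _ v w

variable {I G}

theorem unitChart_symm_unitCoord : (unitChart I G).symm (unitCoord I G) = 1 :=
  extChartAt_to_inv (1 : G)

theorem unitCoord_mem_target : unitCoord I G ∈ (unitChart I G).target :=
  mem_extChartAt_target (1 : G)

theorem eventually_mem_target [I.Boundaryless] :
    ∀ᶠ x in 𝓝 (unitCoord I G), x ∈ (unitChart I G).target :=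
  extChartAt_target_mem_nhds (1 : G)

theorem modelDeriv_one [I.Boundaryless] {F : Type*} [NormedAddCommGroup F] [NormedSpace ℝ F]
    {f : G → F} (hf : MDifferentiableAt I 𝓘(ℝ, F) f 1) :
    modelDeriv I 𝓘(ℝ, F) f 1 = fderiv ℝ (fun y => f ((unitChart I G).symm y)) (unitCoord I G) := by
  refine (if_pos hf).trans ?_
  rw [I.range_eq_univ, fderivWithin_univ]
  rfl

variable [LieGroup I ∞ G]

theorem isManifold_one : IsManifold I 1 G := .of_le (n := ∞) (by simp)

theorem modelDeriv_unitChart_one :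
    modelDeriv I 𝓘(ℝ, E) (unitChart I G) 1 = ContinuousLinearMap.id ℝ E :=
  haveI := isManifold_one (I := I) (G := G)
  mfderiv_extChartAt_self

theorem chartAd_unitCoord : chartAd I G (unitCoord I G) = ContinuousLinearMap.id ℝ E := by
  rw [chartAd, unitChart_symm_unitCoord, AdE_one]

theorem mdifferentiableAt_unitChart {g : G} (hg : g ∈ (unitChart I G).source) :
    MDifferentiableAt I 𝓘(ℝ, E) (unitChart I G) g :=
  haveI := isManifold_one (I := I) (G := G)
  mdifferentiableAt_extChartAt (by simpa using hg)

theorem chartField_unitCoord (v : E) : chartField I G v (unitCoord I G) = v := by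
  rw [chartField, unitChart_symm_unitCoord, modelDeriv_unitChart_one, leftField_eq]
  simp [modelDeriv_id]

variable [I.Boundaryless]

theorem contMDiffAt_unitChart_symm {x : E} (hx : x ∈ (unitChart I G).target) :
    ContMDiffAt 𝓘(ℝ, E) I ∞ (unitChart I G).symm x :=
  (contMDiffOn_extChartAt_symm (1 : G)).contMDiffAt ((isOpen_extChartAt_target _).mem_nhds hx)

theorem mdifferentiableAt_unitChart_symm {x : E} (hx : x ∈ (unitChart I G).target) :
    MDifferentiableAt 𝓘(ℝ, E) I (unitChart I G).symm x :=
  (contMDiffAt_unitChart_symm hx).mdifferentiableAt (by simp)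

theorem modelDeriv_unitChart_comp_symm {x : E} (hx : x ∈ (unitChart I G).target) :
    (modelDeriv I 𝓘(ℝ, E) (unitChart I G) ((unitChart I G).symm x)).comp
      (modelDeriv 𝓘(ℝ, E) I (unitChart I G).symm x) = ContinuousLinearMap.id ℝ E := by
  rw [← modelDeriv_comp x (mdifferentiableAt_unitChart ((unitChart I G).map_target hx))
    (mdifferentiableAt_unitChart_symm hx),
    ← modelDeriv_id (I := 𝓘(ℝ, E)) x]
  exact modelDeriv_congr (eventually_of_mem ((isOpen_extChartAt_target _).mem_nhds hx)
    fun y hy => (unitChart I G).right_inv hy)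

theorem modelDeriv_unitChart_symm_comp {x : E} (hx : x ∈ (unitChart I G).target) :
    (modelDeriv 𝓘(ℝ, E) I (unitChart I G).symm x).comp
    (modelDeriv I 𝓘(ℝ, E) (unitChart I G) ((unitChart I G).symm x))
       = ContinuousLinearMap.id ℝ E := by
  have hs := (unitChart I G).map_target hx
  have := modelDeriv_comp (g := (unitChart I G).symm) ((unitChart I G).symm x)
    (by rw [(unitChart I G).right_inv hx]; exact mdifferentiableAt_unitChart_symm hx)
    (mdifferentiableAt_unitChart hs)
  rw [(unitChart I G).right_inv hx] at this
  rw [← this, ← modelDeriv_id (I := I) ((unitChart I G).symm x)]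
  exact modelDeriv_congr (eventually_of_mem ((isOpen_extChartAt_source _).mem_nhds hs)
    fun y hy => (unitChart I G).left_inv hy)

/-- The derivative of a function along a left-invariant field, computed in the chart. -/
theorem fderiv_comp_symm_chartField {F : Type*} [NormedAddCommGroup F] [NormedSpace ℝ F]
    {f : G → F} {x : E} (hx : x ∈ (unitChart I G).target)
    (hf : MDifferentiableAt I 𝓘(ℝ, F) f ((unitChart I G).symm x)) (v : E) :
    fderiv ℝ (fun y => f ((unitChart I G).symm y)) x (chartField I G v x) =
      modelDeriv I 𝓘(ℝ, F) f ((unitChart I G).symm x) (leftField I v ((unitChart I G).symm x)) := by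
  rw [← modelDeriv_eq_fderiv, modelDeriv_comp x hf (mdifferentiableAt_unitChart_symm hx),
    chartField, ContinuousLinearMap.comp_apply,
    ← ContinuousLinearMap.comp_apply (modelDeriv 𝓘(ℝ, E) I (unitChart I G).symm x),
    modelDeriv_unitChart_symm_comp hx]
  rfl

theorem contDiffAt_chartMul :
    ContDiffAt ℝ ∞ (chartMul I G) (unitCoord I G, unitCoord I G) := by
  rw [← contMDiffAt_iff_contDiffAt]
  have h1 : ContMDiffAt 𝓘(ℝ, E) I ∞ (unitChart I G).symm (unitCoord I G) :=
    contMDiffAt_unitChart_symm unitCoord_mem_target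
  have h2 : ContMDiffAt 𝓘(ℝ, E × E) I ∞
      (fun p : E × E => (unitChart I G).symm p.1 * (unitChart I G).symm p.2)
      (unitCoord I G, unitCoord I G) := by
    have a : ContMDiffAt 𝓘(ℝ, E × E) I ∞ (fun p : E × E => (unitChart I G).symm p.1)
      (unitCoord I G, unitCoord I G) :=
      ContMDiffAt.comp (f := Prod.fst) (unitCoord I G, unitCoord I G) h1
        contDiff_fst.contMDiff.contMDiffAt
    have b : ContMDiffAt 𝓘(ℝ, E × E) I ∞ (fun p : E × E => (unitChart I G).symm p.2)
      (unitCoord I G, unitCoord I G) :=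
      ContMDiffAt.comp (f := Prod.snd) (unitCoord I G, unitCoord I G) h1
        contDiff_snd.contMDiff.contMDiffAt
    exact a.mul b
  refine ContMDiffAt.comp (I' := I) (g := unitChart I G) _ ?_ h2
  rw [unitChart_symm_unitCoord, mul_one]
  exact contMDiffAt_extChartAt

theorem eventually_differentiableAt_chartMul :
    ∀ᶠ p in 𝓝 (unitCoord I G, unitCoord I G), DifferentiableAt ℝ (chartMul I G) p := by
  filter_upwards [((contDiffAt_chartMul (I := I) (G := G)).of_le (n := ∞) (m := 1)
    (by simp)).eventually (by simp)] with p hp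
  exact hp.differentiableAt (by simp)

theorem differentiableAt_fderiv_chartMul :
    DifferentiableAt ℝ (fderiv ℝ (chartMul I G)) (unitCoord I G, unitCoord I G) :=
  (contDiffAt_chartMul.fderiv_right (m := 1) (by norm_num; exact ENat.LEInfty.out)).differentiableAt
    (by simp)

/-- Near the unit, left-invariant fields are partial derivatives of the multiplication. -/
theorem chartField_eq_fderiv_chartMul : ∀ᶠ x in 𝓝 (unitCoord I G), ∀ v,
    chartField I G v x = fderiv ℝ (chartMul I G) (x, unitCoord I G) (0, v) := by
  have hc : Tendsto (fun x : E => (x, unitCoord I G)) (𝓝 (unitCoord I G))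
      (𝓝 (unitCoord I G, unitCoord I G)) :=
    (continuous_id.prodMk continuous_const).tendsto _
  filter_upwards [eventually_mem_target, hc.eventually eventually_differentiableAt_chartMul]
    with x hx hd v
  have hs : (unitChart I G).symm x * 1 ∈ (unitChart I G).source := by
    rw [mul_one]; exact (unitChart I G).map_target hx
  have h1 := mdifferentiableAt_unitChart hs
  have h2 := mdifferentiableAt_mul_left (I := I) ((unitChart I G).symm x) 1
  have h3 := modelDeriv_comp (1 : G) h1 h2
  rw [modelDeriv_one (f := fun y => unitChart I G ((unitChart I G).symm x * y))
    (MDifferentiableAt.comp (1 : G) h1 h2),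
    mul_one] at h3
  rw [chartField, leftField_eq, ← ContinuousLinearMap.comp_apply, ← h3]
  have := hd.hasFDerivAt.comp (unitCoord I G)
    ((hasFDerivAt_const x (unitCoord I G)).prodMk (hasFDerivAt_id (𝕜 := ℝ) (unitCoord I G)))
  exact congrArg (fun L : E →L[ℝ] E => L v) this.fderiv

/-- The identity `R^{Ad_g v}(g) = L^v(g)` between right- and left-invariant fields, in the chart. -/
theorem fderiv_chartMul_chartAd : ∀ᶠ x in 𝓝 (unitCoord I G), ∀ v,
    fderiv ℝ (chartMul I G) (unitCoord I G, x) (chartAd I G x v, 0) = chartField I G v x := by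
  have hc : Tendsto (fun x : E => (unitCoord I G, x)) (𝓝 (unitCoord I G))
      (𝓝 (unitCoord I G, unitCoord I G)) :=
    (continuous_const.prodMk continuous_id).tendsto _
  filter_upwards [eventually_mem_target, hc.eventually eventually_differentiableAt_chartMul]
    with x hx hd v
  have hs : 1 * (unitChart I G).symm x ∈ (unitChart I G).source := by
    rw [one_mul]; exact (unitChart I G).map_target hx
  have h1 := mdifferentiableAt_unitChart hs
  have h2 := mdifferentiableAt_mul_right (I := I) ((unitChart I G).symm x) 1
  have h3 := modelDeriv_comp (1 : G) h1 h2
  rw [modelDeriv_one (f := fun y => unitChart I G (y * (unitChart I G).symm x))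
    (MDifferentiableAt.comp (1 : G) h1 h2),
    one_mul] at h3
  rw [chartField, ← modelDeriv_mul_right_AdE, ← ContinuousLinearMap.comp_apply, ← h3]
  have := hd.hasFDerivAt.comp (unitCoord I G)
    ((hasFDerivAt_id (𝕜 := ℝ) (unitCoord I G)).prodMk (hasFDerivAt_const x (unitCoord I G)))
  exact (congrArg (fun L : E →L[ℝ] E => L (chartAd I G x v)) this.fderiv).symm

theorem contDiffAt_chartAd {x : E} (hx : x ∈ (unitChart I G).target) :
    ContDiffAt ℝ ∞ (chartAd I G) x := by
  rw [← contMDiffAt_iff_contDiffAt]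
  exact ContMDiffAt.comp (g := fun g : G => AdE I g) x contMDiff_AdE.contMDiffAt
    (contMDiffAt_unitChart_symm hx)

theorem fderiv_chartField_unitCoord (v w : E) :
    fderiv ℝ (chartField I G v) (unitCoord I G) w =
    fderiv ℝ (fderiv ℝ (chartMul I G)) (unitCoord I G, unitCoord I G) (w, 0) (0, v) := by
  have h : chartField I G v =ᶠ[𝓝 (unitCoord I G)]
      fun x => fderiv ℝ (chartMul I G) (x, unitCoord I G) (0, v) := by
    filter_upwards [chartField_eq_fderiv_chartMul] with x hx using hx v
  have := (differentiableAt_fderiv_chartMul (I := I) (G := G)).hasFDerivAt.comp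
    (f := fun x => (x, unitCoord I G)) (unitCoord I G)
    ((hasFDerivAt_id (𝕜 := ℝ) (unitCoord I G)).prodMk (hasFDerivAt_const _ _))
  have := this.clm_apply (hasFDerivAt_const ((0, v) : E × E) (unitCoord I G))
  rw [h.fderiv_eq]
  refine (congrArg (fun L : E →L[ℝ] E => L w) this.fderiv).trans ?_
  simp

theorem fderiv_chartMul_inl (u : E) :
    fderiv ℝ (chartMul I G) (unitCoord I G, unitCoord I G) (u, 0) = u := by
  have := (fderiv_chartMul_chartAd (I := I) (G := G)).self_of_nhds u
  rwa [chartAd_unitCoord, chartField_unitCoord] at this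

/-- The derivative at the unit of the adjoint representation, in terms of left-invariant fields.
It is obtained by differentiating `fderiv_chartMul_chartAd` at the unit, where the mixed second
derivatives of the multiplication can be interchanged. -/
theorem fderiv_chartAd_unitCoord (v w : E) :
    fderiv ℝ (chartAd I G) (unitCoord I G) w v =
      fderiv ℝ (chartField I G v) (unitCoord I G) w
        - fderiv ℝ (chartField I G w) (unitCoord I G) v := by
  have hA := ((contDiffAt_chartAd (I := I) (G := G)
    unitCoord_mem_target).differentiableAt (by simp)).hasFDerivAt
  have h1 := hA.clm_apply (hasFDerivAt_const v (unitCoord I G))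
  have h2 := h1.prodMk (hasFDerivAt_const (0 : E) (unitCoord I G))
  have h3 := (differentiableAt_fderiv_chartMul (I := I) (G := G)).hasFDerivAt.comp (unitCoord I G)
    ((hasFDerivAt_const (unitCoord I G) (unitCoord I G)).prodMk
      (hasFDerivAt_id (𝕜 := ℝ) (unitCoord I G)))
  have h4 := h3.clm_apply h2
  have h : chartField I G v =ᶠ[𝓝 (unitCoord I G)]
      fun x => fderiv ℝ (chartMul I G) (unitCoord I G, x) (chartAd I G x v, 0) := by
    filter_upwards [fderiv_chartMul_chartAd] with x hx using (hx v).symm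
  have h5 : fderiv ℝ (chartField I G v) (unitCoord I G) w =
      fderiv ℝ (chartAd I G) (unitCoord I G) w v +
      fderiv ℝ (fderiv ℝ (chartMul I G)) (unitCoord I G, unitCoord I G) (0, w) (v, 0) := by
    rw [h.fderiv_eq]
    refine (congrArg (fun L : E →L[ℝ] E => L w) h4.fderiv).trans ?_
    simp [chartAd_unitCoord, fderiv_chartMul_inl]
  have hsymm : IsSymmSndFDerivAt ℝ (chartMul I G) (unitCoord I G, unitCoord I G) :=
    contDiffAt_chartMul.isSymmSndFDerivAt (by simpa using ENat.LEInfty.out)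
  rw [h5, fderiv_chartField_unitCoord w v, hsymm.eq (v, 0) (0, w)]
  abel

theorem mpullback_symm_eq_chartField {x : E} (hx : x ∈ (unitChart I G).target) (v : E) :
    (mpullback 𝓘(ℝ, E) I (unitChart I G).symm (mulInvariantVectorField (I := I) (G := G) v) x : E)
      = chartField I G v x := by
  have : (modelDeriv 𝓘(ℝ, E) I (unitChart I G).symm x).inverse =
      modelDeriv I 𝓘(ℝ, E) (unitChart I G) ((unitChart I G).symm x) :=
    ContinuousLinearMap.inverse_eq (modelDeriv_unitChart_symm_comp hx)
      (modelDeriv_unitChart_comp_symm hx)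
  exact congrArg (fun L : E →L[ℝ] E => L (leftField I v ((unitChart I G).symm x))) this

variable [CompleteSpace E]

/-- In the chart, the vector field bracket of left-invariant fields is the left-invariant field of
the Lie algebra bracket. -/
theorem lieBracket_chartField {x : E} (hx : x ∈ (unitChart I G).target) (v w : E) :
    lieBracket ℝ (chartField I G v) (chartField I G w) x =
      chartField I G (bracketE I G v w) x := by
  have key := mpullback_mlieBracket (I := 𝓘(ℝ, E)) (I' := I) (f := (unitChart I G).symm) (x₀ := x)
    (V := mulInvariantVectorField (I := I) (G := G) v)
    (W := mulInvariantVectorField (I := I) (G := G) w) (n := ∞)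
    (mdifferentiableAt_mulInvariantVectorField _) (mdifferentiableAt_mulInvariantVectorField _)
    (contMDiffAt_unitChart_symm hx) (by simpa using ENat.LEInfty.out)
  have e := mulInvariantVector_mlieBracket (I := I) (G := G) v w
  rw [← e] at key
  rw [← mpullback_symm_eq_chartField hx]
  refine Eq.trans ?_ key.symm
  have b (V W : E → E) : (mlieBracket 𝓘(ℝ, E) V W x : E) = lieBracket ℝ V W x := by
    have := mlieBracketWithin_eq_lieBracketWithin (𝕜 := ℝ) (V := V) (W := W) (s := univ)
    rw [lieBracketWithin_univ] at this
    exact congrFun this x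
  refine Eq.trans ?_ (b _ _).symm
  refine Filter.EventuallyEq.lieBracket_vectorField_eq ?_ ?_ <;>
  filter_upwards [(isOpen_extChartAt_target _).mem_nhds hx] with y hy using
    (mpullback_symm_eq_chartField hy _).symm

/-- The derivative of `Ad` at the unit is `ad`. -/
theorem fderiv_chartAd_unitCoord_eq_bracketE (v w : E) :
    fderiv ℝ (chartAd I G) (unitCoord I G) w v = bracketE I G w v := by
  rw [fderiv_chartAd_unitCoord, ← chartField_unitCoord (I := I) (G := G) (bracketE I G w v),
    ← lieBracket_chartField unitCoord_mem_target, lieBracket, chartField_unitCoord,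
    chartField_unitCoord]

/-- The derivative of `Ad` along the left-invariant field of `w` is `Ad ∘ ad w`. This follows from
the case of the unit because `Ad` is multiplicative. -/
theorem fderiv_chartAd {x : E} (hx : x ∈ (unitChart I G).target) (v w : E) :
    fderiv ℝ (chartAd I G) x (chartField I G w x) v = chartAd I G x (bracketE I G w v) := by
  have hA (g : G) : MDifferentiableAt I 𝓘(ℝ, E →L[ℝ] E) (fun g : G => AdE I g) g :=
    contMDiff_AdE.contMDiffAt.mdifferentiableAt (by simp)
  have h0 := fderiv_comp_symm_chartField hx (hA _) w
  set g := (unitChart I G).symm x with hg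
  have h1 := modelDeriv_comp (f := fun h : G => g * h) (g := fun g : G => AdE I g) (1 : G)
    (hA _) (mdifferentiableAt_mul_left (I := I) _ _)
  rw [mul_one] at h1
  rw [leftField_eq, ← ContinuousLinearMap.comp_apply, ← h1] at h0
  simp only [AdE_mul] at h0
  have hd : MDifferentiableAt I 𝓘(ℝ, E →L[ℝ] E) (fun h : G => (AdE I g).comp (AdE I h)) 1 := by
    simp only [← AdE_mul]
    exact MDifferentiableAt.comp (g := fun g : G => AdE I g) (1 : G) (hA _)
      (mdifferentiableAt_mul_left (I := I) g 1)
  rw [modelDeriv_one hd] at h0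
  have hc := ((contDiffAt_chartAd (I := I) (G := G)
    unitCoord_mem_target).differentiableAt (by simp)).hasFDerivAt
  have h2 := (hasFDerivAt_const (AdE I g) (unitCoord I G)).clm_comp hc
  have h3 := congrArg (fun L : E →L[ℝ] E →L[ℝ] E => L w) h2.fderiv
  have h4 := congrArg (fun L : E →L[ℝ] E => L v) (h0.trans h3)
  refine h4.trans ?_
  rw [← fderiv_chartAd_unitCoord_eq_bracketE]
  have e : chartAd I G x = AdE I g := rfl
  simp [e]

end

/-! ### The form attached to a derivation -/

section

variable {E : Type*} [NormedAddCommGroup E] [NormedSpace ℝ E]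
  {H : Type*} [TopologicalSpace H] (I : ModelWithCorners ℝ E H)
  (G : Type*) [TopologicalSpace G] [ChartedSpace H G] [Group G]

/-- The frame of left-invariant vector fields, in the chart around the unit. -/
def chartFrame (x : E) : E →L[ℝ] E :=
  (modelDeriv I 𝓘(ℝ, E) (unitChart I G) ((unitChart I G).symm x)).comp
    (modelDeriv I I (fun h : G => (unitChart I G).symm x * h) 1)

/-- `D` is a derivation of the Lie algebra, stated on the model space as the Chevalley-Eilenberg
cocycle condition. -/
def IsDerivation (D : E →L[ℝ] E) : Prop :=
  ∀ v w : E, bracketE I G v (D w) - bracketE I G w (D v) - D (bracketE I G v w) = 0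

variable {G} in
/-- `f` has at `g` the derivative `v ↦ Ad_g (D v)` along left-invariant fields. -/
def IsPrimitiveAt (D : E →L[ℝ] E) (f : G → E) (g : G) : Prop :=
  MDifferentiableAt I 𝓘(ℝ, E) f g ∧
    ∀ v, modelDeriv I 𝓘(ℝ, E) f g (leftField I v g) = AdE I g (D v)

variable {I G}

theorem chartFrame_apply (x v : E) : chartFrame I G x v = chartField I G v x := rfl

variable [LieGroup I ∞ G]

theorem chartFrame_unitCoord : chartFrame I G (unitCoord I G) = ContinuousLinearMap.id ℝ E := by
  ext v
  exact chartField_unitCoord v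

variable [I.Boundaryless]

theorem contDiffAt_chartFrame : ContDiffAt ℝ ∞ (chartFrame I G) (unitCoord I G) := by
  have h : ContDiffAt ℝ ∞ (fun x : E =>
      (fderiv ℝ (chartMul I G) (x, unitCoord I G)).comp (ContinuousLinearMap.inr ℝ E E))
      (unitCoord I G) := by
    have h1 : ContDiffAt ℝ ∞ (fderiv ℝ (chartMul I G)) (unitCoord I G, unitCoord I G) :=
      contDiffAt_chartMul.fderiv_right (by simp)
    have h2 : ContDiffAt ℝ ∞ (fun x : E => fderiv ℝ (chartMul I G) (x, unitCoord I G))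
      (unitCoord I G) := ContDiffAt.comp (f := fun x : E => (x, unitCoord I G)) _ h1
        (contDiffAt_id.prodMk contDiffAt_const)
    exact h2.clm_comp contDiffAt_const
  refine h.congr_of_eventuallyEq ?_
  filter_upwards [chartField_eq_fderiv_chartMul (I := I) (G := G)] with x hx
  ext v
  rw [chartFrame_apply, hx v]
  simp

variable [CompleteSpace E]

/-- The exterior derivative of a `1`-form `η` with `η (v^L) = Ad (D v)` on left-invariant fields is
given by the Chevalley-Eilenberg differential of `D`. This is the formula
`dη (V, W) = V (η W) - W (η V) - η [V, W]`, in which the functions `η (v^L)` are differentiated by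
`fderiv_chartAd`. -/
theorem fderiv_apply_sub_fderiv_apply {η : E → E →L[ℝ] E} {D : E →L[ℝ] E} {x : E}
    (hx : x ∈ (unitChart I G).target) (hc : DifferentiableAt ℝ (chartFrame I G) x)
    (hη : DifferentiableAt ℝ η x)
    (h : ∀ᶠ y in 𝓝 x, ∀ v, η y (chartField I G v y) = chartAd I G y (D v)) (v w : E) :
    fderiv ℝ η x (chartField I G v x) (chartField I G w x) -
      fderiv ℝ η x (chartField I G w x) (chartField I G v x) =
    chartAd I G x (bracketE I G v (D w) - bracketE I G w (D v) - D (bracketE I G v w)) := by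
  have hfield (v : E) : HasFDerivAt (chartField I G v) (fderiv ℝ (chartField I G v) x) x :=
    (hc.clm_apply (differentiableAt_const v)).hasFDerivAt
  have hAd : HasFDerivAt (chartAd I G) (fderiv ℝ (chartAd I G) x) x :=
    ((contDiffAt_chartAd hx).differentiableAt (by simp)).hasFDerivAt
  have key (v w : E) : fderiv ℝ η x (chartField I G w x) (chartField I G v x) +
      η x (fderiv ℝ (chartField I G v) x (chartField I G w x)) =
      chartAd I G x (bracketE I G w (D v)) := by
    have h1 := hη.hasFDerivAt.clm_apply (hfield v)
    have h2 := hAd.clm_apply (hasFDerivAt_const (D v) x)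
    have h3 : (fun y => η y (chartField I G v y)) =ᶠ[𝓝 x] fun y => chartAd I G y (D v) := by
      filter_upwards [h] with y hy using hy v
    have h4 := congrArg (fun L : E →L[ℝ] E => L (chartField I G w x))
      (h1.fderiv.symm.trans (h3.fderiv_eq.trans h2.fderiv))
    rw [← fderiv_chartAd hx]
    simpa [add_comm] using h4
  have hbr := lieBracket_chartField hx v w
  rw [lieBracket] at hbr
  have h5 := h.self_of_nhds (bracketE I G v w)
  rw [← hbr, map_sub] at h5
  rw [map_sub, map_sub, ← key w v, ← key v w, ← h5]
  abel

/-- The Poincaré lemma near the unit, for the `1`-form `v^L ↦ Ad (D v)` attached to a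
derivation `D`. -/
theorem exists_contDiffAt_fderiv_chartField {D : E →L[ℝ] E} (hD : IsDerivation I G D) :
    ∃ f : E → E, ContDiffAt ℝ ∞ f (unitCoord I G) ∧ ∀ᶠ x in 𝓝 (unitCoord I G),
      DifferentiableAt ℝ f x ∧
      ∀ v, fderiv ℝ f x (chartField I G v x) = chartAd I G x (D v) := by
  -- The coordinate expression of the form: a tangent vector is first expanded in the left-invariant
  -- frame, which is invertible near the unit.
  let η : E → E →L[ℝ] E := fun x =>
    ((chartAd I G x).comp D).comp (chartFrame I G x).inverse
  have hη : ContDiffAt ℝ ∞ η (unitCoord I G) := by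
    have h1 : ContDiffAt ℝ ∞ (fun x => (chartFrame I G x).inverse) (unitCoord I G) := by
      refine ContDiffAt.comp (g := ContinuousLinearMap.inverse) (unitCoord I G) ?_
        contDiffAt_chartFrame
      rw [chartFrame_unitCoord]
      exact contDiffAt_map_inverse (ContinuousLinearEquiv.refl ℝ E)
    exact ((contDiffAt_chartAd unitCoord_mem_target).clm_comp contDiffAt_const).clm_comp h1
  have hinv : ∀ᶠ x in 𝓝 (unitCoord I G), ∃ e : E ≃L[ℝ] E, (e : E →L[ℝ] E) = chartFrame I G x := by
    refine contDiffAt_chartFrame.continuousAt.eventually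
      (p := fun L => ∃ e : E ≃L[ℝ] E, (e : E →L[ℝ] E) = L) ?_
    rw [chartFrame_unitCoord]
    exact ContinuousLinearEquiv.nhds (ContinuousLinearEquiv.refl ℝ E)
  have hη' : ∀ᶠ x in 𝓝 (unitCoord I G), ∀ v, η x (chartField I G v x) = chartAd I G x (D v) := by
    filter_upwards [hinv] with x ⟨e, he⟩ v
    simp only [η]
    rw [← chartFrame_apply, ← he, ContinuousLinearMap.inverse_equiv]
    simp
  have d1 : ∀ᶠ x in 𝓝 (unitCoord I G), DifferentiableAt ℝ η x := by
    filter_upwards [(hη.of_le (m := 1) (by simp)).eventually (by simp)] with x hx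
    exact hx.differentiableAt (by simp)
  have d2 : ∀ᶠ x in 𝓝 (unitCoord I G), DifferentiableAt ℝ (chartFrame I G) x := by
    filter_upwards [((contDiffAt_chartFrame (I := I) (G := G)).of_le (m := 1)
      (by simp)).eventually (by simp)] with x hx
    exact hx.differentiableAt (by simp)
  have hall := ((hinv.and hη'.eventually_nhds).and (d1.and d2)).and
    (eventually_mem_target (I := I) (G := G))
  obtain ⟨r, hr, hball⟩ := Metric.eventually_nhds_iff_ball.1 hall
  have hmem : Metric.ball (unitCoord I G) r ∈ 𝓝 (unitCoord I G) := Metric.ball_mem_nhds _ hr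
  obtain ⟨f, hf⟩ := (convex_ball (unitCoord I G) r).exists_forall_hasFDerivAt_of_fderiv_symmetric
    Metric.isOpen_ball
    (show DifferentiableOn ℝ η _ from fun x hx => (hball x hx).1.2.1.differentiableWithinAt) (by
      intro x hx v w
      obtain ⟨⟨⟨⟨e, he⟩, hx1⟩, hx2, hx3⟩, hx4⟩ := hball x hx
      have := fderiv_apply_sub_fderiv_apply hx4 hx3 hx2 hx1 (e.symm v) (e.symm w)
      rw [hD, map_zero] at this
      simp only [← chartFrame_apply, ← he] at this
      simpa [sub_eq_zero] using this)
  refine ⟨f, ?_, ?_⟩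
  · rw [contDiffAt_infty]
    intro n
    have : ContDiffAt ℝ (n + 1) f (unitCoord I G) :=
      contDiffAt_succ_iff_hasFDerivAt.2 ⟨η, ⟨_, hmem, hf⟩, hη.of_le (by exact_mod_cast le_top)⟩
    exact this.of_le (by exact_mod_cast Nat.le_succ n)
  · filter_upwards [hmem] with x hx
    refine ⟨(hf x hx).differentiableAt, ?_⟩
    rw [(hf x hx).fderiv]
    exact (hball x hx).1.1.2.self_of_nhds

end

/-! ### Primitives and cocycles -/

section

variable {E : Type*} [NormedAddCommGroup E] [NormedSpace ℝ E]
  {H : Type*} [TopologicalSpace H] {I : ModelWithCorners ℝ E H}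
  {G : Type*} [TopologicalSpace G] [ChartedSpace H G] [Group G]
  {D D' : E →L[ℝ] E} {f f' : G → E} {g : G}

theorem IsPrimitiveAt.congr (h : IsPrimitiveAt I D f g) (hf : f' =ᶠ[𝓝 g] f) :
    IsPrimitiveAt I D f' g :=
  ⟨h.1.congr_of_eventuallyEq hf, fun v => by rw [modelDeriv_congr hf, h.2]⟩

theorem IsPrimitiveAt.sub (h : IsPrimitiveAt I D f g) (h' : IsPrimitiveAt I D' f' g) :
    IsPrimitiveAt I (D - D') (fun k => f k - f' k) g := by
  refine ⟨h.1.sub h'.1, fun v => ?_⟩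
  have : modelDeriv I 𝓘(ℝ, E) (fun k => f k - f' k) g =
      modelDeriv I 𝓘(ℝ, E) f g - modelDeriv I 𝓘(ℝ, E) f' g := mfderiv_sub h.1 h'.1
  rw [this, sub_apply, h.2, h'.2, ← map_sub]
  rfl

theorem isPrimitiveAt_const (c : E) : IsPrimitiveAt I 0 (fun _ => c) g :=
  ⟨mdifferentiableAt_const, fun v => by simp [modelDeriv_const]⟩

theorem IsPrimitiveAt.add_const (h : IsPrimitiveAt I D f g) (c : E) :
    IsPrimitiveAt I D (fun k => f k + c) g := by
  simpa using h.sub (isPrimitiveAt_const (-c))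

variable [LieGroup I ∞ G]

/-- Primitives can be translated, because `L_a^* η = Ad_a ∘ η` for the form `η (v^L) = Ad (D v)`. -/
theorem IsPrimitiveAt.translate (a : G) (h : IsPrimitiveAt I D f (a⁻¹ * g)) :
    IsPrimitiveAt I D (fun k => AdE I a (f (a⁻¹ * k))) g := by
  have hl := mdifferentiableAt_mul_left (I := I) a⁻¹ g
  have hA : MDifferentiableAt 𝓘(ℝ, E) 𝓘(ℝ, E) (AdE I a) (f (a⁻¹ * g)) :=
    (AdE I a).differentiableAt.mdifferentiableAt
  have hf : MDifferentiableAt I 𝓘(ℝ, E) (fun k => f (a⁻¹ * k)) g :=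
    MDifferentiableAt.comp (g := f) g h.1 hl
  refine ⟨MDifferentiableAt.comp (g := AdE I a) g hA hf, fun v => ?_⟩
  rw [modelDeriv_comp (g := AdE I a) g hA hf, modelDeriv_comp (g := f) g h.1 hl,
    modelDeriv_eq_fderiv, ContinuousLinearMap.fderiv]
  simp only [ContinuousLinearMap.comp_apply]
  rw [← leftField_mul, h.2, ← AdE_mul_apply, mul_inv_cancel_left]

theorem exists_leftField_eq (w : E) (g : G) : ∃ v, leftField I v g = w := by
  have h := modelDeriv_comp (f := fun k : G => g⁻¹ * k) (g := fun k : G => g * k) g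
    (mdifferentiableAt_mul_left (I := I) _ _) (mdifferentiableAt_mul_left (I := I) _ _)
  simp only [mul_inv_cancel_left, inv_mul_cancel, modelDeriv_id] at h
  exact ⟨modelDeriv I I (fun k : G => g⁻¹ * k) g w, congrArg (fun L : E →L[ℝ] E => L w) h.symm⟩

theorem AdE_injective (a : G) : Function.Injective (AdE I a : E →L[ℝ] E) := by
  refine Function.LeftInverse.injective (g := AdE I a⁻¹) fun v => ?_
  rw [← AdE_mul_apply, inv_mul_cancel, AdE_one]
  rfl

theorem IsPrimitiveAt.modelDeriv_eq_zero (h : IsPrimitiveAt I 0 f g) :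
    modelDeriv I 𝓘(ℝ, E) f g = 0 := by
  ext w
  obtain ⟨v, rfl⟩ := exists_leftField_eq (I := I) w g
  rw [h.2]
  simp

/-- A cocycle is a primitive of the form attached to its derivative at `1`: the cocycle identity
expresses it near `g` as a translate of itself near `1`, up to a constant. -/
theorem isPrimitiveAt_of_cocycle (hf : MDifferentiableAt I 𝓘(ℝ, E) f 1)
    (h : ∀ a b, f (a * b) = AdE I a (f b) + f a) (g : G) :
    IsPrimitiveAt I (modelDeriv I 𝓘(ℝ, E) f 1) f g := by
  have h1 : IsPrimitiveAt I (modelDeriv I 𝓘(ℝ, E) f 1) f 1 := by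
    refine ⟨hf, fun v => ?_⟩
    rw [AdE_one, leftField_eq]
    simp [modelDeriv_id]
  have h2 := (IsPrimitiveAt.translate (g := g) g (by simpa using h1)).add_const (f g)
  refine h2.congr (.of_forall fun k => ?_)
  simp only [← h, mul_inv_cancel_left]

/-- By the cocycle identity, smoothness needs to be checked only at `1`. -/
theorem contMDiff_of_cocycle (hf : ContMDiffAt I 𝓘(ℝ, E) ∞ f 1)
    (h : ∀ a b, f (a * b) = AdE I a (f b) + f a) : ContMDiff I 𝓘(ℝ, E) ∞ f := by
  intro g
  have h1 : ContMDiffAt I 𝓘(ℝ, E) ∞ (fun k => f (g⁻¹ * k)) g := by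
    refine ContMDiffAt.comp (g := f) g ?_ contMDiff_mul_left.contMDiffAt
    simpa using hf
  have h2 : ContMDiffAt I 𝓘(ℝ, E) ∞ (fun k => AdE I g (f (g⁻¹ * k)) + f g) g :=
    (ContMDiffAt.comp (g := AdE I g) g (AdE I g).contMDiff.contMDiffAt h1).add contMDiffAt_const
  refine h2.congr_of_eventuallyEq (.of_forall fun k => ?_)
  simp only [← h, mul_inv_cancel_left]

variable [I.Boundaryless]

theorem eventually_eq_of_isPrimitiveAt_zero_one (h : ∀ᶠ k in 𝓝 (1 : G), IsPrimitiveAt I 0 f k) :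
    ∀ᶠ k in 𝓝 (1 : G), f k = f 1 := by
  have hc : Tendsto (unitChart I G).symm (𝓝 (unitCoord I G)) (𝓝 1) := by
    have := (contMDiffAt_unitChart_symm (I := I) (G := G) unitCoord_mem_target).continuousAt.tendsto
    rwa [unitChart_symm_unitCoord] at this
  obtain ⟨r, hr, hball⟩ := Metric.eventually_nhds_iff_ball.1
    ((hc.eventually h).and (eventually_mem_target (I := I) (G := G)))
  have hd : ∀ x ∈ Metric.ball (unitCoord I G) r,
      HasFDerivAt (fun y => f ((unitChart I G).symm y)) (0 : E →L[ℝ] E) x := by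
    intro x hx
    obtain ⟨h1, h2⟩ := hball x hx
    have h3 := mdifferentiableAt_unitChart_symm h2
    have h4 := MDifferentiableAt.comp (g := f) x h1.1 h3
    have h5 := modelDeriv_comp (g := f) x h1.1 h3
    rw [h1.modelDeriv_eq_zero, modelDeriv_eq_fderiv, ContinuousLinearMap.zero_comp] at h5
    rw [← h5]
    exact (mdifferentiableAt_iff_differentiableAt.1 h4).hasFDerivAt
  have hconst : ∀ x ∈ Metric.ball (unitCoord I G) r, f ((unitChart I G).symm x) = f 1 := by
    intro x hx
    have := Metric.isOpen_ball.is_const_of_fderiv_eq_zero (𝕜 := ℝ)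
      (convex_ball (unitCoord I G) r).isPreconnected
      (fun y hy => (hd y hy).differentiableAt.differentiableWithinAt)
      (fun y hy => (hd y hy).fderiv) hx (Metric.mem_ball_self hr)
    simpa only [unitChart_symm_unitCoord] using this
  have h1 : ∀ᶠ k in 𝓝 (1 : G), unitChart I G k ∈ Metric.ball (unitCoord I G) r :=
    (continuousAt_extChartAt (I := I) (1 : G)).eventually (Metric.ball_mem_nhds _ hr)
  filter_upwards [h1, extChartAt_source_mem_nhds (I := I) (1 : G)] with k hk hs
  rw [← hconst _ hk, (unitChart I G).left_inv hs]

/-- Primitives of the zero form are locally constant. -/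
theorem eventually_eq_of_isPrimitiveAt_zero (h : ∀ᶠ k in 𝓝 g, IsPrimitiveAt I 0 f k) :
    ∀ᶠ k in 𝓝 g, f k = f g := by
  have : IsTopologicalGroup G := topologicalGroup_of_lieGroup I ∞
  have hc : Tendsto (fun k : G => g * k) (𝓝 1) (𝓝 g) := by
    simpa using (continuous_const_mul g).tendsto (1 : G)
  have h1 : ∀ᶠ k in 𝓝 (1 : G), IsPrimitiveAt I 0 (fun k => AdE I g⁻¹ (f (g⁻¹⁻¹ * k))) k := by
    filter_upwards [hc.eventually h] with k hk
    exact IsPrimitiveAt.translate g⁻¹ (by simpa using hk)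
  have hc' : Tendsto (fun k : G => g⁻¹ * k) (𝓝 g) (𝓝 1) := by
    simpa using (continuous_const_mul g⁻¹).tendsto g
  filter_upwards [hc'.eventually (eventually_eq_of_isPrimitiveAt_zero_one h1)] with k hk
  simpa using AdE_injective (I := I) g⁻¹ hk

theorem eventually_sub_eq_of_isPrimitiveAt (h : ∀ᶠ k in 𝓝 g, IsPrimitiveAt I D f k)
    (h' : ∀ᶠ k in 𝓝 g, IsPrimitiveAt I D f' k) : ∀ᶠ k in 𝓝 g, f k - f' k = f g - f' g := by
  refine eventually_eq_of_isPrimitiveAt_zero (I := I) (f := fun k => f k - f' k) ?_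
  filter_upwards [h, h'] with k hk hk'
  simpa using hk.sub hk'

/-- A primitive on a connected group is determined by its value at one point. -/
theorem eq_of_isPrimitiveAt [PreconnectedSpace G] (h : ∀ k, IsPrimitiveAt I D f k)
    (h' : ∀ k, IsPrimitiveAt I D f' k) (hg : f g = f' g) (k : G) : f k = f' k := by
  have : IsLocallyConstant (fun k => f k - f' k) :=
    (IsLocallyConstant.iff_eventually_eq _).2 fun k =>
      eventually_sub_eq_of_isPrimitiveAt (.of_forall h) (.of_forall h')
  have := this.apply_eq_of_preconnectedSpace k g
  rwa [hg, sub_self, sub_eq_zero] at this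

/-- A primitive that vanishes at `1` satisfies the cocycle identity: both sides, as functions of
`h`, are primitives with the same value at `h = g`. -/
theorem cocycle_of_isPrimitiveAt [PreconnectedSpace G] (h : ∀ k, IsPrimitiveAt I D f k)
    (h1 : f 1 = 0) (a b : G) : f (a * b) = AdE I a (f b) + f a := by
  have := eq_of_isPrimitiveAt (g := a) h
    (fun k => ((h (a⁻¹ * k)).translate a).add_const (f a)) (by simp [h1]) (a * b)
  simpa using this

variable [CompleteSpace E]

/-- The derivative of a cocycle at `1` is a derivation, because its differential is closed. -/
theorem isDerivation_of_isPrimitiveAt (hf : ContMDiffAt I 𝓘(ℝ, E) ∞ f 1)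
    (h : ∀ k, IsPrimitiveAt I D f k) : IsDerivation I G D := by
  intro v w
  have hF : ContDiffAt ℝ ∞ (fun x => f ((unitChart I G).symm x)) (unitCoord I G) := by
    rw [← contMDiffAt_iff_contDiffAt]
    refine ContMDiffAt.comp (g := f) _ ?_ (contMDiffAt_unitChart_symm unitCoord_mem_target)
    rwa [unitChart_symm_unitCoord]
  have hd : DifferentiableAt ℝ (fderiv ℝ (fun x => f ((unitChart I G).symm x))) (unitCoord I G) :=
    (hF.fderiv_right (m := 1) (by norm_num; exact ENat.LEInfty.out)).differentiableAt (by simp)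
  have := fderiv_apply_sub_fderiv_apply (D := D) unitCoord_mem_target
    (contDiffAt_chartFrame.differentiableAt (by simp)) hd (by
      filter_upwards [eventually_mem_target] with y hy v
      rw [fderiv_comp_symm_chartField hy (h _).1, (h _).2]
      rfl) v w
  have hsymm : IsSymmSndFDerivAt ℝ (fun x => f ((unitChart I G).symm x)) (unitCoord I G) :=
    hF.isSymmSndFDerivAt (by simpa using ENat.LEInfty.out)
  rw [hsymm.eq, sub_self, chartAd_unitCoord] at this
  exact this.symm

theorem exists_isPrimitiveAt_nhds_one (hD : IsDerivation I G D) :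
    ∃ f : G → E, ContMDiffAt I 𝓘(ℝ, E) ∞ f 1 ∧ ∀ᶠ k in 𝓝 (1 : G), IsPrimitiveAt I D f k := by
  obtain ⟨F, hF, hF'⟩ := exists_contDiffAt_fderiv_chartField hD
  refine ⟨fun k => F (unitChart I G k), ?_, ?_⟩
  · exact ContMDiffAt.comp (g := F) (1 : G) hF.contMDiffAt contMDiffAt_extChartAt
  have hc : Tendsto (unitChart I G) (𝓝 1) (𝓝 (unitCoord I G)) :=
    continuousAt_extChartAt (I := I) (1 : G)
  filter_upwards [hc.eventually hF', extChartAt_source_mem_nhds (I := I) (1 : G)]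
    with k ⟨hk, hk'⟩ hs
  have h1 := mdifferentiableAt_unitChart (I := I) hs
  have h2 : MDifferentiableAt 𝓘(ℝ, E) 𝓘(ℝ, E) F (unitChart I G k) := hk.mdifferentiableAt
  refine ⟨MDifferentiableAt.comp (g := F) k h2 h1, fun v => ?_⟩
  rw [modelDeriv_comp (g := F) k h2 h1, modelDeriv_eq_fderiv]
  have := hk' v
  rw [chartField, chartAd, (unitChart I G).left_inv hs] at this
  exact this

/-- On a simply connected group, every derivation integrates to a smooth cocycle. -/
theorem exists_cocycle [SimplyConnectedSpace G] (hD : IsDerivation I G D) :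
    ∃ f : G → E, ContMDiff I 𝓘(ℝ, E) ∞ f ∧ (∀ a b, f (a * b) = AdE I a (f b) + f a) ∧
      modelDeriv I 𝓘(ℝ, E) f 1 = D := by
  have : IsTopologicalGroup G := topologicalGroup_of_lieGroup I ∞
  have : LocallyPathConnectedSpace H :=
    I.toHomeomorph.isOpenEmbedding.locallyPathConnectedSpace
  have : LocallyPathConnectedSpace G := ChartedSpace.locallyPathConnectedSpace H G
  -- Translates `F a` of one primitive `f₀` near `1` are primitives on the translates `U a` of its
  -- domain. Two of them differ by locally constant functions, so they can be glued.
  obtain ⟨f₀, hf₀, hf₀'⟩ := exists_isPrimitiveAt_nhds_one hD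
  obtain ⟨V, hV, hVo, hV1⟩ := eventually_nhds_iff.1 hf₀'
  let U : G → Set G := fun a => (fun k => a⁻¹ * k) ⁻¹' V
  have hU (a : G) : IsOpen (U a) := hVo.preimage (continuous_const_mul a⁻¹)
  let F : G → G → E := fun a k => AdE I a (f₀ (a⁻¹ * k))
  have hF (a k : G) (hk : k ∈ U a) : ∀ᶠ l in 𝓝 k, IsPrimitiveAt I D (F a) l := by
    filter_upwards [(hU a).mem_nhds hk] with l hl
    exact (hV _ hl).translate a
  have hUself (a : G) : a ∈ U a := by simpa [U] using hV1
  obtain ⟨ξ, hξ⟩ := exists_forall_eventually_sub_eq U hU id hUself F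
    fun a b k hk => eventually_sub_eq_of_isPrimitiveAt (hF a k hk.1) (hF b k hk.2)
  let f : G → E := fun k => ξ k - ξ 1
  have hfF (a : G) : f =ᶠ[𝓝 a] fun k => F a k + (ξ a - F a a - ξ 1) := by
    filter_upwards [hξ a a (hUself a)] with k hk
    simp only [f, ← hk]
    abel
  have hfp (k : G) : IsPrimitiveAt I D f k :=
    ((hF k k (hUself k)).self_of_nhds.add_const _).congr (hfF k)
  have hcoc := cocycle_of_isPrimitiveAt hfp (by simp [f])
  refine ⟨f, contMDiff_of_cocycle ?_ hcoc, hcoc, ?_⟩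
  · refine ContMDiffAt.congr_of_eventuallyEq ?_ (hfF 1)
    refine ContMDiffAt.add ?_ contMDiffAt_const
    simpa [F, AdE_one] using hf₀
  · ext v
    have := (hfp 1).2 v
    rw [AdE_one, leftField_eq] at this
    simpa [modelDeriv_id] using this

end

/-! ### Smooth cocycles and Chevalley-Eilenberg cocycles -/

section

variable {E : Type*} [NormedAddCommGroup E] [NormedSpace ℝ E]
  {H : Type*} [TopologicalSpace H] {I : ModelWithCorners ℝ E H}
  {G : Type*} [TopologicalSpace G] [ChartedSpace H G] [Group G]

theorem mem_smoothOneCocycles {ξ : SmoothOneCochain I G} : ξ ∈ smoothOneCocycles I G ↔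
    ∀ a b : G, (ξ (a * b) : E) = AdE I a (ξ b) + ξ a := Iff.rfl

theorem mem_ceOneCocycles {L : Type*} [LieRing L] [LieAlgebra ℝ L] {δ : L →ₗ[ℝ] L} :
    δ ∈ ceOneCocycles L ↔ ∀ x y : L, ⁅x, δ y⁆ - ⁅y, δ x⁆ - δ ⁅x, y⁆ = 0 := by
  rw [ceOneCocycles, LinearMap.mem_ker]
  constructor
  · intro h x y
    rw [← LieModule.Cohomology.d₁₂_apply_apply, h]
    rfl
  · intro h
    ext x y
    exact h x y

theorem mem_ceOneCocycles_iff_exists_lieDerivation {L : Type*} [LieRing L] [LieAlgebra ℝ L]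
    {δ : L →ₗ[ℝ] L} :
    δ ∈ ceOneCocycles L ↔ ∃ D : LieDerivation ℝ L L, (D : L →ₗ[ℝ] L) = δ := by
  rw [mem_ceOneCocycles]
  constructor
  · intro h
    exact ⟨{ toLinearMap := δ, leibniz' := fun a b => (sub_eq_zero.1 (h a b)).symm }, rfl⟩
  · rintro ⟨D, rfl⟩ x y
    exact sub_eq_zero.2 (D.leibniz' x y).symm

/-- Chevalley-Eilenberg `1`-cocycles with adjoint coefficients are the same as derivations. -/
def ceOneCocyclesEquiv (L : Type*) [LieRing L] [LieAlgebra ℝ L] :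
    ceOneCocycles L ≃ₗ[ℝ] LieDerivation ℝ L L where
  toFun δ := { toLinearMap := δ
               leibniz' := fun a b => (sub_eq_zero.1 (mem_ceOneCocycles.1 δ.2 a b)).symm }
  invFun D := ⟨D, mem_ceOneCocycles_iff_exists_lieDerivation.2 ⟨D, rfl⟩⟩
  map_add' _ _ := rfl
  map_smul' _ _ := rfl
  left_inv _ := rfl
  right_inv _ := rfl

variable [LieGroup I ∞ G]

theorem mem_ceOneCocycles_iff_isDerivation [CompleteSpace E] {D : E →L[ℝ] E} :
    (D.toLinearMap : GroupLieAlgebra I G →ₗ[ℝ] GroupLieAlgebra I G) ∈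
      ceOneCocycles (GroupLieAlgebra I G) ↔ IsDerivation I G D :=
  mem_ceOneCocycles

theorem isPrimitiveAt_of_mem_smoothOneCocycles {ξ : SmoothOneCochain I G}
    (hξ : ξ ∈ smoothOneCocycles I G) (g : G) :
    IsPrimitiveAt I (modelDeriv I 𝓘(ℝ, E) (fun g => (ξ g : E)) 1) (fun g => (ξ g : E)) g :=
  isPrimitiveAt_of_cocycle (ξ.contMDiff.contMDiffAt.mdifferentiableAt (by simp))
    (mem_smoothOneCocycles.1 hξ) g

variable [I.Boundaryless]

theorem tangentMap₁_mem_ceOneCocycles [CompleteSpace E] {ξ : SmoothOneCochain I G}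
    (hξ : ξ ∈ smoothOneCocycles I G) :
    tangentMap₁ I G ξ ∈ ceOneCocycles (GroupLieAlgebra I G) :=
  mem_ceOneCocycles_iff_isDerivation.2 (isDerivation_of_isPrimitiveAt ξ.contMDiff.contMDiffAt
    (isPrimitiveAt_of_mem_smoothOneCocycles hξ))

theorem eq_of_tangentMap₁_eq [PreconnectedSpace G] {ξ η : SmoothOneCochain I G}
    (hξ : ξ ∈ smoothOneCocycles I G) (hη : η ∈ smoothOneCocycles I G)
    (h : tangentMap₁ I G ξ = tangentMap₁ I G η) : ξ = η := by
  have hD : modelDeriv I 𝓘(ℝ, E) (fun g => (ξ g : E)) 1 =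
      modelDeriv I 𝓘(ℝ, E) (fun g => (η g : E)) 1 := by
    ext v
    exact congrArg (fun L : GroupLieAlgebra I G →ₗ[ℝ] GroupLieAlgebra I G => L v) h
  have h1 {ζ : SmoothOneCochain I G} (hζ : ζ ∈ smoothOneCocycles I G) : (ζ 1 : E) = 0 := by
    simpa [AdE_one] using mem_smoothOneCocycles.1 hζ 1 1
  ext g
  refine eq_of_isPrimitiveAt (I := I) (g := 1) (isPrimitiveAt_of_mem_smoothOneCocycles hξ) ?_
    ((h1 hξ).trans (h1 hη).symm) g
  rw [hD]
  exact isPrimitiveAt_of_mem_smoothOneCocycles hη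

theorem exists_mem_smoothOneCocycles [FiniteDimensional ℝ E] [SimplyConnectedSpace G]
    {δ : GroupLieAlgebra I G →ₗ[ℝ] GroupLieAlgebra I G}
    (hδ : δ ∈ ceOneCocycles (GroupLieAlgebra I G)) :
    ∃ ξ ∈ smoothOneCocycles I G, tangentMap₁ I G ξ = δ := by
  let D : E →L[ℝ] E := LinearMap.toContinuousLinearMap (E := E) (F' := E) δ
  obtain ⟨f, hf, hcoc, hD⟩ := exists_cocycle (I := I) (G := G) (D := D)
    (mem_ceOneCocycles_iff_isDerivation.1 hδ)
  refine ⟨⟨f, hf⟩, mem_smoothOneCocycles.2 hcoc, ?_⟩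
  ext v
  exact congrArg (fun L : E →L[ℝ] E => L v) hD

/-- The tangent map at the unit, as an isomorphism from smooth group cocycles to
Chevalley-Eilenberg cocycles. -/
def smoothOneCocyclesEquiv (I : ModelWithCorners ℝ E H) [I.Boundaryless]
    (G : Type*) [TopologicalSpace G] [ChartedSpace H G] [Group G] [LieGroup I ∞ G]
    [FiniteDimensional ℝ E] [SimplyConnectedSpace G] :
    smoothOneCocycles I G ≃ₗ[ℝ] ceOneCocycles (GroupLieAlgebra I G) :=
  LinearEquiv.ofBijective
    ((tangentMap₁ I G).restrict fun _ hξ => tangentMap₁_mem_ceOneCocycles hξ)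
    ⟨fun ξ η h => Subtype.ext (eq_of_tangentMap₁_eq ξ.2 η.2 (congrArg Subtype.val h)),
      fun δ => by
        obtain ⟨ξ, hξ, h⟩ := exists_mem_smoothOneCocycles δ.2
        exact ⟨⟨ξ, hξ⟩, Subtype.ext h⟩⟩

end

end VanEst

end

theorem mainTheorem3
    {E : Type*} [NormedAddCommGroup E] [NormedSpace ℝ E] [FiniteDimensional ℝ E]
    {H : Type*} [TopologicalSpace H] (I : ModelWithCorners ℝ E H) [I.Boundaryless]
    (G : Type*) [TopologicalSpace G] [ChartedSpace H G] [Group G] [LieGroup I ∞ G]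
    [T2Space G] [SecondCountableTopology G] [SimplyConnectedSpace G] :
    (∃ Φ : VanEst.smoothOneCocycles I G ≃ₗ[ℝ] VanEst.ceOneCocycles (GroupLieAlgebra I G),
      ∀ ξ : VanEst.smoothOneCocycles I G,
        (Φ ξ : GroupLieAlgebra I G →ₗ[ℝ] GroupLieAlgebra I G) =
          VanEst.tangentMap₁ I G (ξ : VanEst.SmoothOneCochain I G)) ∧
    (∃ Ψ : VanEst.smoothOneCocycles I G ≃ₗ[ℝ]
          LieDerivation ℝ (GroupLieAlgebra I G) (GroupLieAlgebra I G),
      ∀ ξ : VanEst.smoothOneCocycles I G,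
        (Ψ ξ : GroupLieAlgebra I G →ₗ[ℝ] GroupLieAlgebra I G) =
          VanEst.tangentMap₁ I G (ξ : VanEst.SmoothOneCochain I G)) ∧
    (∀ δ : GroupLieAlgebra I G →ₗ[ℝ] GroupLieAlgebra I G,
      δ ∈ VanEst.ceOneCocycles (GroupLieAlgebra I G) ↔
        ∃ D : LieDerivation ℝ (GroupLieAlgebra I G) (GroupLieAlgebra I G),
          (D : GroupLieAlgebra I G →ₗ[ℝ] GroupLieAlgebra I G) = δ) :=
  ⟨⟨VanEst.smoothOneCocyclesEquiv I G, fun _ => rfl⟩,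
    ⟨(VanEst.smoothOneCocyclesEquiv I G).trans
      (VanEst.ceOneCocyclesEquiv (GroupLieAlgebra I G)), fun _ => rfl⟩,
    fun _ => VanEst.mem_ceOneCocycles_iff_exists_lieDerivation⟩
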